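/- For $n \ge 3$ let $SG_n$ be the singular braid group on $n$ strands, that is, the group with generators $\sigma_1,\dots,\sigma_{n-1},\rho_1,\dots,\rho_{n-1}$ and defining relations $$\sigma_i\sigma_j=\sigma_j\sigma_i \quad\text{and}\quad \rho_i\rho_j=\rho_j\rho_i \quad (|i-j|>1),$$ $$\sigma_i\sigma_{i+1}\sigma_i=\sigma_{i+1}\sigma_i\sigma_{i+1},\qquad \rho_i\sigma_{i+1}\sigma_i=\sigma_{i+1}\sigma_i\rho_{i+1},\qquad \rho_{i+1}\sigma_i\sigma_{i+1}=\sigma_i\sigma_{i+1}\rho_i \quad (1\le i\le n-2),$$ $$\sigma_i\rho_j=\rho_j\sigma_i \quad (i=j \text{ or } |i-j|>1).$$ Let $SG_n'$ be its commutator subgroup and $SG_n''$ the commutator subgroup of $SG_n'$. Then: (i) For every $n\ge 5$, $SG_n'$ is finitely generated, and its rank (the minimal number of generators) is at most $2n-4$. (ii) $SG_3'$ and $SG_4'$ are not finitely generated. Moreover, $SG_3'/SG_3''$ is isomorphic to the free abelian group of countably infinite rank $\bigoplus_{i=1}^{\infty}\mathbb Z$. (iii) For $n\ge 3$, $SG_n'$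 is perfect (equal to its own commutator subgroup) if and only if $n\ge 5$. -/

import Mathlib

/-- The `2(n-1)` generators `σ_i`, `ρ_i` of the singular braid group on `n` strands.
The index set `{1, …, n-1}` is `Fin (n - 1)`, shifted by one. -/
inductive SingularBraidGen (n : ℕ) : Type
  | sigma (i : Fin (n - 1)) : SingularBraidGen n
  | rho (i : Fin (n - 1)) : SingularBraidGen n

namespace SingularBraid

/-- `σ_i` as an element of the free group on the generators. -/
def s {n : ℕ} (i : Fin (n - 1)) : FreeGroup (SingularBraidGen n) :=
  FreeGroup.of (SingularBraidGen.sigma i)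

/-- `ρ_i` as an element of the free group on the generators. -/
def r {n : ℕ} (i : Fin (n - 1)) : FreeGroup (SingularBraidGen n) :=
  FreeGroup.of (SingularBraidGen.rho i)

/-- `|i - j| > 1`. -/
def Far {n : ℕ} (i j : Fin (n - 1)) : Prop :=
  (i : ℕ) + 1 < j ∨ (j : ℕ) + 1 < i

/-- The defining relators of the singular braid group; a relation `u = v` is encoded as the
relator `u * v⁻¹`. The hypothesis `(j : ℕ) = i + 1` says that `j` is the index `i + 1`. -/
inductive Relator (n : ℕ) : FreeGroup (SingularBraidGen n) → Prop
  | sigma_comm (i j : Fin (n - 1)) (h : Far i j) :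
      Relator n ((s i * s j) * (s j * s i)⁻¹)
  | sigma_braid (i j : Fin (n - 1)) (h : (j : ℕ) = i + 1) :
      Relator n ((s i * s j * s i) * (s j * s i * s j)⁻¹)
  | rho_comm (i j : Fin (n - 1)) (h : Far i j) :
      Relator n ((r i * r j) * (r j * r i)⁻¹)
  | mixed_left (i j : Fin (n - 1)) (h : (j : ℕ) = i + 1) :
      Relator n ((r i * s j * s i) * (s j * s i * r j)⁻¹)
  | mixed_right (i j : Fin (n - 1)) (h : (j : ℕ) = i + 1) :
      Relator n ((r j * s i * s j) * (s i * s j * r i)⁻¹)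
  | sigma_rho_comm (i j : Fin (n - 1)) (h : i = j ∨ Far i j) :
      Relator n ((s i * r j) * (r j * s i)⁻¹)

end SingularBraid

/-- The singular braid group `SG_n` on `n` strands. -/
abbrev SingularBraidGroup (n : ℕ) : Type :=
  PresentedGroup {w : FreeGroup (SingularBraidGen n) | SingularBraid.Relator n w}

/-! Write G for SG_n. All σ_i are conjugate, and so are all ρ_i, so each σ_i σ_1⁻¹ and ρ_i ρ_1⁻¹
lies in G'.

For n ≥ 5, let H be the subgroup generated by these 2(n - 2) elements. Conjugation by σ_1 fixes a
generator of index i ≥ 3. On one of index 2 it agrees with conjugation by (σ_4 σ_1⁻¹)⁻¹ ∈ H, since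
σ_4 commutes with everything of index 1 or 2. The same holds for ρ_1. So H is normal, G/H is
generated by the commuting images of σ_1 and ρ_1, and H = G' (`closure_quotientGenerators`). For
perfectness, G' becomes abelian in G/G'', which forces σ_1 and σ_2 to commute there; the braid
relation then makes them equal. All σ_i coincide, then all ρ_i (`mk_sigma_eq`, `mk_rho_eq`), so
G/G'' is abelian.

For n = 3, `affineRep` represents G by affine maps of A = ℤ[r, r⁻¹][s]/(s² - s + 1), with G' acting
by translations. The generators of G' in `translationGen` translate by r^k and r^k s, a ℤ-basis of
A, so their classes form a basis of G'/G''. For n = 4, `fold` maps SG_4 onto SG_3, hence SG_4' onto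
SG_3', and both negative statements pass up. -/

section GroupLemmas

/-! ### Normalizers and commutator subgroups in general groups -/

variable {G : Type*} [Group G]

/-- Both directions are needed, as conjugation can map an infinite subgroup properly into itself. -/
theorem Subgroup.mem_normalizer_closure_of_forall {S : Set G} {a : G}
    (h : ∀ x ∈ S, a * x * a⁻¹ ∈ closure S) (h' : ∀ x ∈ S, a⁻¹ * x * a ∈ closure S) :
    a ∈ normalizer (closure S : Set G) := by
  have key : ∀ b : G, (∀ x ∈ S, b * x * b⁻¹ ∈ closure S) →
      ∀ x ∈ closure S, b * x * b⁻¹ ∈ closure S := by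
    intro b hb x hx
    have : closure S ≤ (closure S).comap (MulAut.conj b).toMonoidHom :=
      (closure_le _).2 fun y hy => by simpa using hb y hy
    simpa using this hx
  refine mem_normalizer_iff.2 fun x => ⟨key a h x, fun hx => ?_⟩
  have := key a⁻¹ (by simpa using h') _ hx
  simpa [mul_assoc] using this

/-- A subgroup normalized by two commuting elements, which together with them generates the group,
contains the commutator subgroup. -/
theorem Subgroup.commutator_le_of_mem_normalizer {H : Subgroup G} {a b : G} (hab : Commute a b)
    (ha : a ∈ normalizer (H : Set G)) (hb : b ∈ normalizer (H : Set G))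
    (htop : H ⊔ closure {a, b} = ⊤) : _root_.commutator G ≤ H := by
  have hN : normalizer (H : Set G) = ⊤ := by
    rw [eq_top_iff, ← htop, sup_le_iff, closure_le]
    refine ⟨le_normalizer, ?_⟩
    rintro x (rfl | rfl) <;> assumption
  have : H.Normal := normalizer_eq_top_iff.1 hN
  refine Normal.commutator_le_of_self_sup_commutative_eq_top htop ?_
  refine isMulCommutative_closure ?_
  rintro x (rfl | rfl) y (rfl | rfl)
  exacts [rfl, hab.eq, hab.eq.symm, rfl]

theorem Subgroup.mul_inv_mem_commutator_of_isConj {a b : G} (h : IsConj a b) :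
    a * b⁻¹ ∈ _root_.commutator G := by
  obtain ⟨c, rfl⟩ := isConj_iff.1 h
  have := commutator_mem_commutator (mem_top a) (mem_top c)
  rw [_root_.commutator_def]
  convert this using 1
  rw [commutatorElement_def]; group

/-- If `x` and `y` commute and satisfy the braid relation, they are equal. -/
theorem eq_of_commute_of_braid {x y : G} (hc : Commute x y) (hb : x * y * x = y * x * y) :
    x = y := by
  rw [hc.eq, mul_assoc, mul_assoc] at hb
  have := mul_left_cancel hb
  exact mul_left_cancel this

variable {H : Type*} [Group H]

theorem MonoidHom.map_commutator_of_surjective {f : G →* H} (hf : Function.Surjective f) :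
    (commutator G).map f = commutator H := by
  rw [commutator_def, commutator_def, Subgroup.map_commutator, Subgroup.map_top_of_surjective f hf]

/-- A surjective homomorphism induces a surjection of commutator subgroups. -/
theorem MonoidHom.exists_surjective_commutator {f : G →* H} (hf : Function.Surjective f) :
    ∃ g : commutator G →* commutator H, Function.Surjective g := by
  have h := map_commutator_of_surjective hf
  refine ⟨(MulEquiv.subgroupCongr h).toMonoidHom.comp (f.subgroupMap (commutator G)), ?_⟩
  exact (MulEquiv.subgroupCongr h).surjective.comp (f.subgroupMap_surjective _)

end GroupLemmas

/-! ### Relations and conjugacy of the generators of SG_n -/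

namespace SingularBraid

variable {n : ℕ}

/-- The image of `σ_i` in the singular braid group. -/
def sigma (i : Fin (n - 1)) : SingularBraidGroup n := PresentedGroup.of (.sigma i)

/-- The image of `ρ_i` in the singular braid group. -/
def rho (i : Fin (n - 1)) : SingularBraidGroup n := PresentedGroup.of (.rho i)

theorem mk_eq_mk {u v : FreeGroup (SingularBraidGen n)} (h : Relator n (u * v⁻¹)) :
    PresentedGroup.mk {w | Relator n w} u = PresentedGroup.mk {w | Relator n w} v :=
  mul_inv_eq_one.1 (by
    rw [← map_inv, ← map_mul]
    exact PresentedGroup.one_of_mem (rels := {w | Relator n w}) h)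

theorem sigma_commute {i j : Fin (n - 1)} (h : Far i j) : Commute (sigma i) (sigma j) :=
  mk_eq_mk (.sigma_comm i j h)

theorem sigma_braid {i j : Fin (n - 1)} (h : (j : ℕ) = i + 1) :
    sigma i * sigma j * sigma i = sigma j * sigma i * sigma j :=
  mk_eq_mk (.sigma_braid i j h)

theorem rho_commute {i j : Fin (n - 1)} (h : Far i j) : Commute (rho i) (rho j) :=
  mk_eq_mk (.rho_comm i j h)

theorem rho_mul_sigma_mul_sigma {i j : Fin (n - 1)} (h : (j : ℕ) = i + 1) :
    rho i * sigma j * sigma i = sigma j * sigma i * rho j :=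
  mk_eq_mk (.mixed_left i j h)

theorem rho_succ_mul_sigma_mul_sigma {i j : Fin (n - 1)} (h : (j : ℕ) = i + 1) :
    rho j * sigma i * sigma j = sigma i * sigma j * rho i :=
  mk_eq_mk (.mixed_right i j h)

theorem sigma_commute_rho {i j : Fin (n - 1)} (h : i = j ∨ Far i j) :
    Commute (sigma i) (rho j) :=
  mk_eq_mk (.sigma_rho_comm i j h)

theorem eq_top_of_mem {H : Subgroup (SingularBraidGroup n)} (hs : ∀ i, sigma i ∈ H)
    (hr : ∀ i, rho i ∈ H) : H = ⊤ := by
  rw [eq_top_iff, ← PresentedGroup.closure_range_of, Subgroup.closure_le]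
  rintro _ ⟨i | i, rfl⟩
  exacts [hs i, hr i]

theorem isConj_sigma_succ {i j : Fin (n - 1)} (h : (j : ℕ) = i + 1) :
    IsConj (sigma i) (sigma j) :=
  isConj_iff.2 ⟨sigma i * sigma j, by
    rw [mul_inv_eq_iff_eq_mul, sigma_braid h, mul_assoc]⟩

theorem isConj_rho_succ {i j : Fin (n - 1)} (h : (j : ℕ) = i + 1) :
    IsConj (rho i) (rho j) :=
  isConj_iff.2 ⟨sigma i * sigma j, by
    rw [mul_inv_eq_iff_eq_mul, ← rho_succ_mul_sigma_mul_sigma h, mul_assoc]⟩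

/-- Induction on the index of a generator. -/
theorem fin_induction {P : Fin (n - 1) → Prop} {i : Fin (n - 1)} (hi : (i : ℕ) = 0) (h0 : P i)
    (hs : ∀ i j : Fin (n - 1), (j : ℕ) = i + 1 → P i → P j) (j : Fin (n - 1)) : P j := by
  obtain ⟨j, hj⟩ := j
  induction j with
  | zero => convert h0; exact hi.symm
  | succ k ih => exact hs ⟨k, by omega⟩ _ rfl (ih (by omega))

theorem isConj_sigma {i : Fin (n - 1)} (hi : (i : ℕ) = 0) (j : Fin (n - 1)) :
    IsConj (sigma i) (sigma j) :=
  fin_induction (P := fun j => IsConj (sigma i) (sigma j)) hi (IsConj.refl _)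
    (fun _ _ h h' => h'.trans (isConj_sigma_succ h)) j

theorem isConj_rho {i : Fin (n - 1)} (hi : (i : ℕ) = 0) (j : Fin (n - 1)) :
    IsConj (rho i) (rho j) :=
  fin_induction (P := fun j => IsConj (rho i) (rho j)) hi (IsConj.refl _)
    (fun _ _ h h' => h'.trans (isConj_rho_succ h)) j

end SingularBraid

/-! ### The case n ≥ 5: generators of SG_n' and perfectness -/

namespace SingularBraid

variable {n : ℕ}

/-- Lets the normalizer argument treat the two families σ and ρ uniformly. -/
theorem commute_of_eq_or_far {c d : Fin (n - 1) → SingularBraidGroup n}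
    (hc : c = sigma ∨ c = rho) (hd : d = sigma ∨ d = rho) {i j : Fin (n - 1)}
    (h : i = j ∨ Far i j) : Commute (c i) (d j) := by
  have hfar : Far i j → Far j i := Or.symm
  rcases hc with rfl | rfl <;> rcases hd with rfl | rfl
  · rcases h with rfl | h
    exacts [Commute.refl _, sigma_commute h]
  · exact sigma_commute_rho h
  · exact (sigma_commute_rho (h.imp Eq.symm hfar)).symm
  · rcases h with rfl | h
    exacts [Commute.refl _, rho_commute h]

/-- The elements `σ_i σ_1⁻¹` and `ρ_i ρ_1⁻¹` with `i ≠ 1`, where `z` stands for the first index. -/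
noncomputable def quotientGenerators (z : Fin (n - 1)) : Finset (SingularBraidGroup n) := by
  classical
  exact (Finset.univ.erase z).image (fun i => sigma i * (sigma z)⁻¹) ∪
    (Finset.univ.erase z).image (fun i => rho i * (rho z)⁻¹)

theorem card_quotientGenerators_le (z : Fin (n - 1)) :
    (quotientGenerators z).card ≤ 2 * n - 4 := by
  classical
  have h : (Finset.univ.erase z).card = n - 2 := by
    rw [Finset.card_erase_of_mem (Finset.mem_univ z), Finset.card_univ, Fintype.card_fin]
    omega
  refine (Finset.card_union_le _ _).trans ((add_le_add Finset.card_image_le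
    Finset.card_image_le).trans ?_)
  rw [h]
  omega

theorem mem_quotientGenerators {z : Fin (n - 1)} {x : SingularBraidGroup n} :
    x ∈ quotientGenerators z ↔
      ∃ c, (c = sigma ∨ c = rho) ∧ ∃ i, i ≠ z ∧ c i * (c z)⁻¹ = x := by
  simp [quotientGenerators, or_and_right, exists_or]

theorem mul_inv_mem_closure_quotientGenerators {c : Fin (n - 1) → SingularBraidGroup n}
    (hc : c = sigma ∨ c = rho) (z i : Fin (n - 1)) :
    c i * (c z)⁻¹ ∈ Subgroup.closure (quotientGenerators z : Set (SingularBraidGroup n)) := by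
  by_cases h : i = z
  · rw [h, mul_inv_cancel]
    exact one_mem _
  · exact Subgroup.subset_closure (mem_quotientGenerators.2 ⟨c, hc, i, h, rfl⟩)

theorem mem_normalizer_closure_quotientGenerators (hn : 5 ≤ n)
    {b : Fin (n - 1) → SingularBraidGroup n} (hb : b = sigma ∨ b = rho) {z : Fin (n - 1)}
    (hz : (z : ℕ) = 0) :
    b z ∈ Subgroup.normalizer
      (Subgroup.closure (quotientGenerators z : Set (SingularBraidGroup n)) :
        Set (SingularBraidGroup n)) := by
  set H := Subgroup.closure (quotientGenerators z : Set (SingularBraidGroup n)) with hH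
  have key : ∀ x ∈ quotientGenerators z, ∃ k, Commute (b z) (b k) ∧ Commute (b k) x := by
    intro x hx
    obtain ⟨c, hc, i, hi, rfl⟩ := mem_quotientGenerators.1 hx
    have hi' : (i : ℕ) ≠ 0 := fun h => hi (Fin.ext (h.trans hz.symm))
    by_cases h1 : (i : ℕ) = 1
    -- Index 3 stands for σ_4 or ρ_4, which exists because n ≥ 5 and is far from both indices 0 and
    -- 1.
    · refine ⟨⟨3, by omega⟩, commute_of_eq_or_far hb hb ?_,
        .mul_right (commute_of_eq_or_far hb hc ?_)
          (commute_of_eq_or_far hb hc ?_).inv_right⟩ <;>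
      · right
        simp only [Far]
        omega
    · refine ⟨z, .refl _, .mul_right (commute_of_eq_or_far hb hc ?_)
          (commute_of_eq_or_far hb hc (.inl rfl)).inv_right⟩
      right
      simp only [Far]
      omega
  refine Subgroup.mem_normalizer_closure_of_forall (fun x hx => ?_) (fun x hx => ?_) <;>
    obtain ⟨k, h1, h2⟩ := key x hx <;>
    have hk := mul_inv_mem_closure_quotientGenerators hb z k <;>
    have hx' : x ∈ H := Subgroup.subset_closure hx
  -- Since `b k` fixes x, conjugating by `b z` is the same as conjugating by `b z * (b k)⁻¹`, an
  -- element of `H`.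
  · have h3 : (b k * (b z)⁻¹)⁻¹ * x * (b k * (b z)⁻¹) ∈ H :=
      mul_mem (mul_mem (inv_mem hk) hx') hk
    convert h3 using 1
    calc b z * x * (b z)⁻¹ = b z * ((b k)⁻¹ * (x * b k)) * (b z)⁻¹ := by
          rw [← h2.eq, inv_mul_cancel_left]
      _ = _ := by group
  · have h3 : (b k * (b z)⁻¹) * x * (b k * (b z)⁻¹)⁻¹ ∈ H :=
      mul_mem (mul_mem hk hx') (inv_mem hk)
    convert h3 using 1
    rw [← h1.inv_left.eq]
    calc (b z)⁻¹ * x * b z = (b z)⁻¹ * (b k * x * (b k)⁻¹) * b z := by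
          rw [h2.eq, mul_inv_cancel_right]
      _ = _ := by group

/-- For `n ≥ 5` the commutator subgroup of `SG_n` is generated by the `σ_i σ_1⁻¹` and
`ρ_i ρ_1⁻¹`. -/
theorem closure_quotientGenerators (hn : 5 ≤ n) {z : Fin (n - 1)} (hz : (z : ℕ) = 0) :
    Subgroup.closure (quotientGenerators z : Set (SingularBraidGroup n)) =
      commutator (SingularBraidGroup n) := by
  refine le_antisymm ?_ ?_
  · rw [Subgroup.closure_le]
    intro x hx
    obtain ⟨c, rfl | rfl, i, hi, rfl⟩ := mem_quotientGenerators.1 hx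
    · exact Subgroup.mul_inv_mem_commutator_of_isConj (isConj_sigma hz i).symm
    · exact Subgroup.mul_inv_mem_commutator_of_isConj (isConj_rho hz i).symm
  · refine Subgroup.commutator_le_of_mem_normalizer
      (commute_of_eq_or_far (.inl rfl) (.inr rfl) (.inl rfl) : Commute (sigma z) (rho z))
      (mem_normalizer_closure_quotientGenerators hn (.inl rfl) hz)
      (mem_normalizer_closure_quotientGenerators hn (.inr rfl) hz) (eq_top_of_mem ?_ ?_) <;> intro i
    · rw [← inv_mul_cancel_right (sigma i) (sigma z)]
      exact Subgroup.mul_mem_sup (mul_inv_mem_closure_quotientGenerators (.inl rfl) z i)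
        (Subgroup.subset_closure (by simp))
    · rw [← inv_mul_cancel_right (rho i) (rho z)]
      exact Subgroup.mul_mem_sup (mul_inv_mem_closure_quotientGenerators (.inr rfl) z i)
        (Subgroup.subset_closure (by simp))

theorem exists_fg_commutator_and_rank_le (hn : 5 ≤ n) :
    ∃ _ : Group.FG (commutator (SingularBraidGroup n)),
      Group.rank (commutator (SingularBraidGroup n)) ≤ 2 * n - 4 := by
  rw [← closure_quotientGenerators hn (z := ⟨0, by omega⟩) rfl]
  exact ⟨inferInstance,
    (Subgroup.rank_closure_finset_le_card _).trans (card_quotientGenerators_le _)⟩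

/-- For `n ≥ 5` all `σ_i` agree modulo the second derived subgroup. -/
theorem mk_sigma_eq (hn : 5 ≤ n) {z : Fin (n - 1)} (hz : (z : ℕ) = 0) (i : Fin (n - 1)) :
    (sigma i : SingularBraidGroup n ⧸
      ⁅commutator (SingularBraidGroup n), commutator (SingularBraidGroup n)⁆) = sigma z := by
  set K := commutator (SingularBraidGroup n)
  let q := QuotientGroup.mk' ⁅K, K⁆
  have hbraid : ∀ {i j : Fin (n - 1)}, (j : ℕ) = i + 1 →
      q (sigma i) * q (sigma j) * q (sigma i) = q (sigma j) * q (sigma i) * q (sigma j) := by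
    intro i j h
    simp only [← map_mul, sigma_braid h]
  have hzero_one : ∀ j : Fin (n - 1), (j : ℕ) = 1 → q (sigma j) = q (sigma z) := by
    intro j hj
    let k : Fin (n - 1) := ⟨3, by omega⟩
    have hx : sigma z * (sigma j)⁻¹ ∈ K :=
      Subgroup.mul_inv_mem_commutator_of_isConj (isConj_sigma hz j)
    have hy : sigma z * (sigma k)⁻¹ ∈ K :=
      Subgroup.mul_inv_mem_commutator_of_isConj (isConj_sigma hz k)
    -- The image of `K` modulo its own commutator subgroup is abelian.
    have hxy : Commute (q (sigma z * (sigma k)⁻¹)) (q (sigma z * (sigma j)⁻¹)) := by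
      rw [← commutatorElement_eq_one_iff_commute, ← map_commutatorElement]
      exact (QuotientGroup.eq_one_iff _).2 (Subgroup.commutator_mem_commutator hy hx)
    have hk : Commute (sigma k) (sigma z * (sigma j)⁻¹) :=
      .mul_right (sigma_commute (.inr (by simp [k, hz])))
        (sigma_commute (.inr (by simp [k, hj]))).inv_right
    -- The image of σ_1 σ_2⁻¹ commutes with those of σ_1 σ_4⁻¹ and σ_4, hence of σ_1; so the images
    -- of σ_1 and σ_2 commute.
    have h := hxy.mul_left (hk.map q)
    rw [← map_mul, inv_mul_cancel_right] at h
    have h' := (Commute.refl (q (sigma z))).inv_right.mul_right h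
    rw [map_mul, inv_mul_cancel_left, map_inv, Commute.inv_right_iff] at h'
    exact (eq_of_commute_of_braid h' (hbraid (by omega))).symm
  refine fin_induction (P := fun i => q (sigma i) = q (sigma z)) hz rfl (fun i j hij h => ?_) i
  by_cases hi : (i : ℕ) = 0
  · exact hzero_one j (by omega)
  -- By induction σ_i may be replaced by σ_1, which is far from σ_j as j is not one of the first two
  -- indices.
  · have hc : Commute (q (sigma i)) (q (sigma j)) := by
      rw [h]
      exact (sigma_commute (.inl (by omega))).map q
    rw [← h, eq_of_commute_of_braid hc (hbraid hij)]

/-- For `n ≥ 5` all `ρ_i` agree modulo the second derived subgroup. -/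
theorem mk_rho_eq (hn : 5 ≤ n) {z : Fin (n - 1)} (hz : (z : ℕ) = 0) (i : Fin (n - 1)) :
    (rho i : SingularBraidGroup n ⧸
      ⁅commutator (SingularBraidGroup n), commutator (SingularBraidGroup n)⁆) = rho z := by
  let q := QuotientGroup.mk'
    ⁅commutator (SingularBraidGroup n), commutator (SingularBraidGroup n)⁆
  refine fin_induction (P := fun i => q (rho i) = q (rho z)) hz rfl (fun i j hij h => ?_) i
  have hs : q (sigma i) = q (sigma j) :=
    (mk_sigma_eq hn hz i).trans (mk_sigma_eq hn hz j).symm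
  have hc : Commute (q (sigma j)) (q (rho j)) := (sigma_commute_rho (.inl rfl)).map q
  -- With σ_i = σ_j the relation reads ρ_i σ_j² = σ_j² ρ_j = ρ_j σ_j².
  have hm := congrArg q (rho_mul_sigma_mul_sigma hij)
  simp only [map_mul, hs] at hm
  rw [(hc.mul_left hc).eq, ← mul_assoc] at hm
  rw [← h, mul_right_cancel (mul_right_cancel hm)]

theorem isPerfect_commutator (hn : 5 ≤ n) :
    Group.IsPerfect (commutator (SingularBraidGroup n)) := by
  rw [Subgroup.isPerfect_iff]
  refine le_antisymm (Subgroup.commutator_le_self _) ?_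
  have hz : ((⟨0, by omega⟩ : Fin (n - 1)) : ℕ) = 0 := rfl
  generalize (⟨0, by omega⟩ : Fin (n - 1)) = z at hz
  set N := ⁅commutator (SingularBraidGroup n), commutator (SingularBraidGroup n)⁆
  have hN : ∀ x, x ∈ Subgroup.normalizer (N : Set (SingularBraidGroup n)) := by
    simp [Subgroup.normalizer_eq_top]
  refine Subgroup.commutator_le_of_mem_normalizer
    (sigma_commute_rho (.inl rfl) : Commute (sigma z) (rho z)) (hN _) (hN _)
    (eq_top_of_mem ?_ ?_) <;> intro i
  · rw [← mul_inv_cancel_left (sigma z) (sigma i), sup_comm]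
    exact Subgroup.mul_mem_sup (Subgroup.subset_closure (by simp))
      (QuotientGroup.eq.1 (mk_sigma_eq hn hz i).symm)
  · rw [← mul_inv_cancel_left (rho z) (rho i), sup_comm]
    exact Subgroup.mul_mem_sup (Subgroup.subset_closure (by simp))
      (QuotientGroup.eq.1 (mk_rho_eq hn hz i).symm)

end SingularBraid

/-! ### The affine representation of SG_3 -/

namespace SingularBraid

open LaurentPolynomial QuadraticAlgebra

/-- The ring `ℤ[r, r⁻¹][s] / (s² - s + 1)`. -/
abbrev EisensteinLaurent : Type := QuadraticAlgebra ℤ[T;T⁻¹] (-1) 1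

namespace EisensteinLaurent

theorem omega_mul_self : (ω * ω : EisensteinLaurent) = ω - 1 := by
  ext1 <;> simp

/-- `s` as a unit. -/
noncomputable def unitOmega : EisensteinLaurentˣ where
  val := ω
  inv := 1 - ω
  val_inv := by linear_combination -omega_mul_self
  inv_val := by linear_combination -omega_mul_self

/-- `r` as a unit. -/
noncomputable def unitT : EisensteinLaurentˣ where
  val := algebraMap _ _ (T 1 : ℤ[T;T⁻¹])
  inv := algebraMap _ _ (T (-1) : ℤ[T;T⁻¹])
  val_inv := by rw [← map_mul, ← T_add]; simp
  inv_val := by rw [← map_mul, ← T_add]; simp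

theorem val_unitT_zpow (k : ℤ) :
    ((unitT ^ k : EisensteinLaurentˣ) : EisensteinLaurent) =
      algebraMap _ _ (T k : ℤ[T;T⁻¹]) := by
  induction k with
  | zero => simp
  | succ k ih => rw [zpow_add_one, Units.val_mul, ih, T_add, map_mul]; rfl
  | pred k ih => rw [zpow_sub_one, Units.val_mul, ih, sub_eq_add_neg, T_add, map_mul]; rfl

/-- The monomials `r^k` and `r^k s` form a basis over `ℤ`. -/
noncomputable def coeffEquiv : EisensteinLaurent ≃+ (ℤ ⊕ ℤ →₀ ℤ) :=
  ({ QuadraticAlgebra.equivProd (-1 : ℤ[T;T⁻¹]) 1 with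
      map_add' := fun _ _ => rfl } : EisensteinLaurent ≃+ ℤ[T;T⁻¹] × ℤ[T;T⁻¹]).trans <|
    (AddMonoidAlgebra.coeffAddEquiv.prodCongr AddMonoidAlgebra.coeffAddEquiv).trans
      Finsupp.sumFinsuppAddEquivProdFinsupp.symm

theorem coeffEquiv_unitT_zpow (k : ℤ) :
    coeffEquiv ((unitT ^ k : EisensteinLaurentˣ) : EisensteinLaurent) =
      Finsupp.single (Sum.inl k) 1 := by
  rw [val_unitT_zpow]
  change Finsupp.sumElim (Finsupp.single k 1) (0 : ℤ →₀ ℤ) = _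
  ext (i | i) <;> simp [Finsupp.single_apply]

theorem coeffEquiv_unitT_zpow_mul_omega (k : ℤ) :
    coeffEquiv (((unitT ^ k * unitOmega) : EisensteinLaurentˣ) : EisensteinLaurent) =
      Finsupp.single (Sum.inr k) 1 := by
  have h : ((unitT ^ k * unitOmega : EisensteinLaurentˣ) : EisensteinLaurent) = ⟨0, T k⟩ := by
    rw [Units.val_mul, val_unitT_zpow]
    ext1 <;> simp [unitOmega]
  rw [h]
  change Finsupp.sumElim (0 : ℤ →₀ ℤ) (Finsupp.single k 1) = _
  ext (i | i) <;> simp [Finsupp.single_apply]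

end EisensteinLaurent

open EisensteinLaurent

/-- The action of the units by multiplication. -/
noncomputable def unitsAction : EisensteinLaurentˣ →* MulAut (Multiplicative EisensteinLaurent) :=
  (MulAutMultiplicative EisensteinLaurent).symm.toMonoidHom.comp
    (DistribMulAction.toAddAut EisensteinLaurentˣ EisensteinLaurent)

/-- The affine group of the ring. -/
abbrev AffineGroup : Type :=
  Multiplicative EisensteinLaurent ⋊[unitsAction] EisensteinLaurentˣ

/-- The affine map `y ↦ u y + x`. -/
noncomputable def affine (x : EisensteinLaurent) (u : EisensteinLaurentˣ) : AffineGroup := ⟨.ofAdd x, u⟩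

theorem affine_mul_affine (x y : EisensteinLaurent) (u v : EisensteinLaurentˣ) :
    affine x u * affine y v = affine (x + u * y) (u * v) := rfl

/-- The homomorphism out of the singular braid group given by images of the generators. -/
def lift {n : ℕ} {G : Type*} [Group G] (a b : Fin (n - 1) → G)
    (aa : ∀ i j, Far i j → a i * a j = a j * a i)
    (aba : ∀ i j : Fin (n - 1), (j : ℕ) = i + 1 → a i * a j * a i = a j * a i * a j)
    (bb : ∀ i j, Far i j → b i * b j = b j * b i)
    (baa : ∀ i j : Fin (n - 1), (j : ℕ) = i + 1 → b i * a j * a i = a j * a i * b j)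
    (baa' : ∀ i j : Fin (n - 1), (j : ℕ) = i + 1 → b j * a i * a j = a i * a j * b i)
    (ab : ∀ i j, i = j ∨ Far i j → a i * b j = b j * a i) : SingularBraidGroup n →* G :=
  PresentedGroup.toGroup (f := fun g => match g with | .sigma i => a i | .rho i => b i) (by
    rintro _ (⟨i, j, h⟩ | ⟨i, j, h⟩ | ⟨i, j, h⟩ | ⟨i, j, h⟩ | ⟨i, j, h⟩ | ⟨i, j, h⟩) <;>
      rw [map_mul, map_inv, mul_inv_eq_one] <;> simp only [s, r, map_mul, FreeGroup.lift_apply_of]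
    exacts [aa i j h, aba i j h, bb i j h, baa i j h, baa' i j h, ab i j h])

section

variable {n : ℕ} {G : Type*} [Group G] {a b : Fin (n - 1) → G} {aa aba bb baa baa' ab}

@[simp]
theorem lift_sigma (i : Fin (n - 1)) : lift a b aa aba bb baa baa' ab (sigma i) = a i :=
  PresentedGroup.toGroup.of _

@[simp]
theorem lift_rho (i : Fin (n - 1)) : lift a b aa aba bb baa baa' ab (rho i) = b i :=
  PresentedGroup.toGroup.of _

end

theorem not_far_three {i j : Fin (3 - 1)} : ¬ Far i j := by
  simp only [Far]
  omega

theorem eq_zero_and_eq_one {i j : Fin (3 - 1)} (h : (j : ℕ) = i + 1) :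
    i = (0 : Fin 2) ∧ j = (1 : Fin 2) := by
  refine ⟨Fin.ext ?_, Fin.ext ?_⟩
  · change (i : ℕ) = 0
    omega
  · change (j : ℕ) = 1
    omega

theorem unitOmega_mul_self :
    (unitOmega * unitOmega : EisensteinLaurent) = unitOmega - 1 :=
  omega_mul_self

theorem affine_congr {x y : EisensteinLaurent} {u v : EisensteinLaurentˣ} (h : x = y)
    (h' : u = v) : affine x u = affine y v := by
  rw [h, h']

/-- The affine representation of `SG_3`: `σ_1, σ_2, ρ_1, ρ_2` act as `y ↦ s y`, `y ↦ s y + 1`,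
`y ↦ r y` and `y ↦ r y + (1 - r) s`. -/
noncomputable def affineRep : SingularBraidGroup 3 →* AffineGroup :=
  lift (n := 3) ![affine 0 unitOmega, affine 1 unitOmega]
    -- The relation ρ_2 σ_1 σ_2 = σ_1 σ_2 ρ_1 forces ρ_2 to have centre σ_1 σ_2(0) = s. As 1 = (1 -
    -- s) s, the map σ_2 also fixes s, so it commutes with ρ_2.
    ![affine 0 unitT, affine ((1 - unitT) * unitOmega) unitT]
    (fun _ _ h => (not_far_three h).elim)
    (fun i j h => by
      obtain ⟨rfl, rfl⟩ := eq_zero_and_eq_one h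
      simp only [Matrix.cons_val_zero, Matrix.cons_val_one, affine_mul_affine]
      -- Comparing translation parts gives s = 1 + s², the defining relation of the ring.
      refine affine_congr ?_ rfl
      push_cast
      linear_combination -unitOmega_mul_self)
    (fun _ _ h => (not_far_three h).elim)
    (fun i j h => by
      obtain ⟨rfl, rfl⟩ := eq_zero_and_eq_one h
      simp only [Matrix.cons_val_zero, Matrix.cons_val_one, affine_mul_affine]
      refine affine_congr ?_ (mul_rotate _ _ _)
      push_cast
      -- Amounts to s³ = -1, from s³ + 1 = (s + 1)(s² - s + 1).
      linear_combination ((unitT : EisensteinLaurent) - 1) * (unitOmega + 1) * unitOmega_mul_self)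
    (fun i j h => by
      obtain ⟨rfl, rfl⟩ := eq_zero_and_eq_one h
      simp only [Matrix.cons_val_zero, Matrix.cons_val_one, affine_mul_affine]
      refine affine_congr ?_ (mul_rotate _ _ _)
      push_cast
      ring)
    (fun i j h => by
      obtain rfl | h := h
      · have hi : i = (0 : Fin 2) ∨ i = (1 : Fin 2) := by
          rcases i with ⟨_ | _ | i, hi⟩
          exacts [.inl rfl, .inr rfl, by omega]
        rcases hi with rfl | rfl <;>
          simp only [Matrix.cons_val_zero, Matrix.cons_val_one, affine_mul_affine] <;>
          refine affine_congr ?_ (mul_comm _ _)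
        · ring
        · linear_combination (1 - (unitT : EisensteinLaurent)) * unitOmega_mul_self
      · exact (not_far_three h).elim)

/-- The linear part takes values in the commutative group of units. -/
theorem right_affineRep_of_mem {x : SingularBraidGroup 3}
    (hx : x ∈ commutator (SingularBraidGroup 3)) : (affineRep x).right = 1 :=
  (Abelianization.commutator_subset_ker (SemidirectProduct.rightHom.comp affineRep)) hx

/-- The commutator subgroup of `SG_3` acts by translations. -/
noncomputable def translation :
    commutator (SingularBraidGroup 3) →* Multiplicative EisensteinLaurent where
  toFun x := (affineRep x).left
  map_one' := by simp
  map_mul' x y := by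
    rw [Subgroup.coe_mul, map_mul, SemidirectProduct.mul_left, right_affineRep_of_mem x.2, map_one,
      MulAut.one_apply]

/-- The generators of `SG_3'`: the conjugates by `ρ_1^k` of `σ_2 σ_1⁻¹` and `σ_1 σ_2 σ_1⁻²`. -/
def translationGen : ℤ ⊕ ℤ → SingularBraidGroup 3
  | .inl k => rho (0 : Fin 2) ^ k * (sigma (1 : Fin 2) * (sigma (0 : Fin 2))⁻¹) *
      (rho (0 : Fin 2) ^ k)⁻¹
  | .inr k => rho (0 : Fin 2) ^ k * (sigma (0 : Fin 2) *
      (sigma (1 : Fin 2) * (sigma (0 : Fin 2))⁻¹) * (sigma (0 : Fin 2))⁻¹) * (rho (0 : Fin 2) ^ k)⁻¹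

theorem translationGen_mem (p : ℤ ⊕ ℤ) :
    translationGen p ∈ commutator (SingularBraidGroup 3) := by
  have h : sigma (1 : Fin 2) * (sigma (0 : Fin 2))⁻¹ ∈ commutator (SingularBraidGroup 3) :=
    Subgroup.mul_inv_mem_commutator_of_isConj (isConj_sigma (n := 3) rfl _).symm
  have hN : (commutator (SingularBraidGroup 3)).Normal := inferInstance
  rcases p with k | k
  · exact hN.conj_mem _ h _
  · exact hN.conj_mem _ (hN.conj_mem _ h _) _

/-- Conjugation by ρ_1 shifts k. Conjugation by σ_1 acts on the two families as multiplication by s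
does on 1 and s, with the braid relation supplying lifts of s² = s - 1 and s⁻¹ = 1 - s. -/
theorem closure_range_translationGen :
    Subgroup.closure (Set.range translationGen) = commutator (SingularBraidGroup 3) := by
  refine le_antisymm ?_ ?_
  · rw [Subgroup.closure_le]
    rintro _ ⟨p, rfl⟩
    exact translationGen_mem p
  have hb : sigma (n := 3) (0 : Fin 2) * sigma (1 : Fin 2) * sigma (0 : Fin 2) =
      sigma (1 : Fin 2) * sigma (0 : Fin 2) * sigma (1 : Fin 2) := sigma_braid rfl
  have hm : rho (n := 3) (1 : Fin 2) * sigma (0 : Fin 2) * sigma (1 : Fin 2) =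
      sigma (0 : Fin 2) * sigma (1 : Fin 2) * rho (0 : Fin 2) := rho_succ_mul_sigma_mul_sigma rfl
  have hc : Commute (sigma (n := 3) (0 : Fin 2)) (rho (0 : Fin 2)) := sigma_commute_rho (.inl rfl)
  have hmem : ∀ p, translationGen p ∈ Subgroup.closure (Set.range translationGen) :=
    fun p => Subgroup.subset_closure ⟨p, rfl⟩
  have htop : ∀ i : Fin (3 - 1), i = (0 : Fin 2) ∨ i = (1 : Fin 2) := by
    rintro ⟨_ | _ | i, hi⟩
    exacts [.inl rfl, .inr rfl, by omega]
  have h0 : translationGen (.inl 0) = sigma (1 : Fin 2) * (sigma (0 : Fin 2))⁻¹ := by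
    simp [translationGen]
  have hu : sigma (1 : Fin 2) * (sigma (0 : Fin 2))⁻¹ ∈
      Subgroup.closure (Set.range translationGen) := h0 ▸ hmem _
  generalize hs : sigma (n := 3) (0 : Fin 2) = a at *
  generalize ht : sigma (n := 3) (1 : Fin 2) = b at *
  generalize hr : rho (n := 3) (0 : Fin 2) = c at *
  generalize hr' : rho (n := 3) (1 : Fin 2) = d at *
  have hinl : ∀ k, translationGen (.inl k) = c ^ k * (b * a⁻¹) * (c ^ k)⁻¹ := by
    intro k
    simp only [translationGen, hs, ht, hr]
  have hinr : ∀ k, translationGen (.inr k) = c ^ k * (a * (b * a⁻¹) * a⁻¹) * (c ^ k)⁻¹ := by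
    intro k
    simp only [translationGen, hs, ht, hr]
  have hac : ∀ (k : ℤ) (x : SingularBraidGroup 3),
      a * (c ^ k * x * (c ^ k)⁻¹) * a⁻¹ = c ^ k * (a * x * a⁻¹) * (c ^ k)⁻¹ := by
    intro k x
    have h1 := (hc.zpow_right k).eq
    have h2 := (hc.zpow_right k).inv_inv.eq
    calc _ = (a * c ^ k) * x * ((c ^ k)⁻¹ * a⁻¹) := by group
      _ = _ := by rw [h1, ← h2]; group
  have hac' : ∀ (k : ℤ) (x : SingularBraidGroup 3),
      a⁻¹ * (c ^ k * x * (c ^ k)⁻¹) * a = c ^ k * (a⁻¹ * x * a) * (c ^ k)⁻¹ := by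
    intro k x
    have h1 := (hc.zpow_right k).inv_left.eq
    have h2 := (hc.zpow_right k).inv_right.eq
    calc _ = (a⁻¹ * c ^ k) * x * ((c ^ k)⁻¹ * a) := by group
      _ = _ := by rw [h1, ← h2]; group
  refine Subgroup.commutator_le_of_mem_normalizer hc ?_ ?_ (eq_top_of_mem ?_ ?_)
  · refine Subgroup.mem_normalizer_closure_of_forall ?_ ?_
    · rintro _ ⟨k | k, rfl⟩
      · rw [hinl, hac, ← hinr]
        exact hmem _
      -- The group form of s · s = -1 + s.
      · have h : c ^ k * (a * (a * (b * a⁻¹) * a⁻¹) * a⁻¹) * (c ^ k)⁻¹ =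
            (translationGen (.inl k))⁻¹ * translationGen (.inr k) := by
          have h' : a * b * a⁻¹ = b⁻¹ * (a * b) := by
            rw [mul_inv_eq_iff_eq_mul, mul_assoc b⁻¹, hb, mul_assoc, inv_mul_cancel_left]
          rw [hinl, hinr]
          calc _ = c ^ k * (a * (a * b * a⁻¹) * a⁻¹ * a⁻¹) * (c ^ k)⁻¹ := by group
            _ = _ := by rw [h']; group
        rw [hinr, hac, h]
        exact mul_mem (inv_mem (hmem _)) (hmem _)
    · rintro _ ⟨k | k, rfl⟩
      -- The group form of s⁻¹ = 1 - s.
      · have h : c ^ k * (a⁻¹ * (b * a⁻¹) * a) * (c ^ k)⁻¹ =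
            translationGen (.inl k) * (translationGen (.inr k))⁻¹ := by
          have h' : b * a * b⁻¹ = a⁻¹ * (b * a) := by
            rw [mul_inv_eq_iff_eq_mul, mul_assoc a⁻¹, ← hb, mul_assoc, inv_mul_cancel_left]
          rw [hinl, hinr]
          calc _ = c ^ k * (a⁻¹ * (b * a) * a⁻¹) * (c ^ k)⁻¹ := by group
            _ = _ := by rw [← h']; group
        rw [hinl, hac', h]
        exact mul_mem (hmem _) (inv_mem (hmem _))
      · have h : c ^ k * (a⁻¹ * (a * (b * a⁻¹) * a⁻¹) * a) * (c ^ k)⁻¹ =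
            translationGen (.inl k) := by
          rw [hinl]
          group
        rw [hinr, hac', h]
        exact hmem _
  · refine Subgroup.mem_normalizer_closure_of_forall ?_ ?_
    · rintro _ ⟨k | k, rfl⟩
      · convert hmem (.inl (k + 1)) using 1
        rw [hinl, hinl]
        group
      · convert hmem (.inr (k + 1)) using 1
        rw [hinr, hinr]
        group
    · rintro _ ⟨k | k, rfl⟩
      · convert hmem (.inl (k - 1)) using 1
        rw [hinl, hinl]
        group
      · convert hmem (.inr (k - 1)) using 1
        rw [hinr, hinr]
        group
  all_goals
    have ha : a ∈ Subgroup.closure (Set.range translationGen) ⊔ Subgroup.closure {a, c} :=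
      Subgroup.mem_sup_right (Subgroup.subset_closure (by simp))
    have hc' : c ∈ Subgroup.closure (Set.range translationGen) ⊔ Subgroup.closure {a, c} :=
      Subgroup.mem_sup_right (Subgroup.subset_closure (by simp))
    have hb' : b ∈ Subgroup.closure (Set.range translationGen) ⊔ Subgroup.closure {a, c} := by
      have := mul_mem (Subgroup.mem_sup_left hu) ha
      rwa [inv_mul_cancel_right] at this
    intro i
    obtain rfl | rfl := htop i
  · rwa [hs]
  · rwa [ht]
  · rwa [hr]
  · have hd : d = a * b * c * (a * b)⁻¹ := by
      rw [eq_mul_inv_iff_mul_eq, ← hm, mul_assoc]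
    rw [hr', hd]
    exact mul_mem (mul_mem (mul_mem ha hb') hc') (inv_mem (mul_mem ha hb'))

end SingularBraid

/-! ### The abelianization of SG_3' -/

namespace SingularBraid

open EisensteinLaurent

theorem affine_zero_zpow (u : EisensteinLaurentˣ) (k : ℤ) : affine 0 u ^ k = affine 0 (u ^ k) :=
  (map_zpow (SemidirectProduct.inr (φ := unitsAction)) u k).symm

theorem affine_zero_conj (u : EisensteinLaurentˣ) (x : EisensteinLaurent) :
    affine 0 u * affine x 1 * (affine 0 u)⁻¹ = affine (u * x) 1 := by
  rw [mul_inv_eq_iff_eq_mul, affine_mul_affine, affine_mul_affine]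
  simp

theorem affineRep_sigma_div :
    affineRep (sigma (1 : Fin 2) * (sigma (0 : Fin 2))⁻¹) = affine 1 1 := by
  rw [map_mul, map_inv, mul_inv_eq_iff_eq_mul]
  simp [affineRep, affine_mul_affine]

/-- The monomial basis of the translation lattice. -/
noncomputable def monomial : ℤ ⊕ ℤ → EisensteinLaurentˣ
  | .inl k => unitT ^ k
  | .inr k => unitT ^ k * unitOmega

theorem coeffEquiv_monomial (p : ℤ ⊕ ℤ) :
    coeffEquiv (monomial p : EisensteinLaurent) = Finsupp.single p 1 := by
  rcases p with k | k
  exacts [coeffEquiv_unitT_zpow k, coeffEquiv_unitT_zpow_mul_omega k]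

theorem affineRep_translationGen (p : ℤ ⊕ ℤ) :
    affineRep (translationGen p) = affine (monomial p) 1 := by
  have hs : affineRep (sigma (0 : Fin 2)) = affine 0 unitOmega := by simp [affineRep]
  have hr : affineRep (rho (0 : Fin 2)) = affine 0 unitT := by simp [affineRep]
  rcases p with k | k
  · rw [translationGen, map_mul, map_mul, map_inv, map_zpow, affineRep_sigma_div, hr,
      affine_zero_zpow, affine_zero_conj, mul_one, monomial]
  · rw [translationGen, map_mul, map_mul, map_inv, map_zpow, map_mul _ _ (sigma _)⁻¹,
      map_mul _ (sigma _), map_inv, affineRep_sigma_div, hr, hs, affine_zero_conj,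
      affine_zero_zpow, affine_zero_conj, mul_one, monomial, Units.val_mul]

theorem translation_translationGen (p : ℤ ⊕ ℤ) :
    translation ⟨translationGen p, translationGen_mem p⟩ = .ofAdd (monomial p) :=
  congrArg SemidirectProduct.left (affineRep_translationGen p)

/-- The coordinates of the translation part. -/
noncomputable def coordinates :
    Abelianization (commutator (SingularBraidGroup 3)) →* Multiplicative (ℤ ⊕ ℤ →₀ ℤ) :=
  Abelianization.lift (coeffEquiv.toMultiplicative.toMonoidHom.comp translation)

/-- The class of a generator of `SG_3'` in the abelianization. -/
def abelianizedGen (p : ℤ ⊕ ℤ) : Abelianization (commutator (SingularBraidGroup 3)) :=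
  .of ⟨translationGen p, translationGen_mem p⟩

theorem coordinates_abelianizedGen (p : ℤ ⊕ ℤ) :
    coordinates (abelianizedGen p) = .ofAdd (Finsupp.single p 1) := by
  rw [coordinates, abelianizedGen, Abelianization.lift_apply_of, ← coeffEquiv_monomial,
    MonoidHom.comp_apply, translation_translationGen]
  rfl

/-- The element of the abelianization with given coordinates. -/
noncomputable def ofCoordinates :
    Multiplicative (ℤ ⊕ ℤ →₀ ℤ) →* Abelianization (commutator (SingularBraidGroup 3)) :=
  AddMonoidHom.toMultiplicativeLeft (Finsupp.liftAddHom fun p =>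
    zmultiplesHom (Additive (Abelianization (commutator (SingularBraidGroup 3))))
      (.ofMul (abelianizedGen p)))

theorem ofCoordinates_single (p : ℤ ⊕ ℤ) :
    ofCoordinates (.ofAdd (Finsupp.single p 1)) = abelianizedGen p := by
  simp [ofCoordinates]

theorem closure_range_abelianizedGen :
    Subgroup.closure (Set.range abelianizedGen) = ⊤ := by
  have h : Subgroup.closure (Set.range fun p =>
      (⟨translationGen p, translationGen_mem p⟩ : commutator (SingularBraidGroup 3))) = ⊤ := by
    apply Subgroup.map_injective (commutator (SingularBraidGroup 3)).subtype_injective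
    rw [MonoidHom.map_closure, ← Set.range_comp, ← MonoidHom.range_eq_map, Subgroup.range_subtype]
    exact closure_range_translationGen
  have h' := congrArg (Subgroup.map Abelianization.of) h
  rwa [MonoidHom.map_closure, ← Set.range_comp, Subgroup.map_top_of_surjective Abelianization.of
    (QuotientGroup.mk'_surjective _)] at h'

/-- `SG_3' / SG_3''` is free abelian on the classes of the generators. -/
noncomputable def coordinatesEquiv :
    Abelianization (commutator (SingularBraidGroup 3)) ≃* Multiplicative (ℤ ⊕ ℤ →₀ ℤ) :=
  -- The generators go to a basis, so the map back exists by freeness and both composites are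
  -- checked on generators.
  coordinates.toMulEquiv ofCoordinates
    (MonoidHom.eq_of_eqOn_dense closure_range_abelianizedGen (by
      rintro _ ⟨p, rfl⟩
      rw [MonoidHom.comp_apply, coordinates_abelianizedGen, ofCoordinates_single]
      rfl))
    (by
      apply AddMonoidHom.toMultiplicative.symm.injective
      ext p : 2
      simpa using congrArg Multiplicative.toAdd ((congrArg coordinates (ofCoordinates_single p)).trans
        (coordinates_abelianizedGen p)))

theorem nonempty_abelianization_mulEquiv :
    Nonempty (Abelianization (commutator (SingularBraidGroup 3)) ≃* Multiplicative (ℕ →₀ ℤ)) :=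
  ⟨coordinatesEquiv.trans (Finsupp.domCongr (Denumerable.eqv (ℤ ⊕ ℤ))).toMultiplicative⟩

theorem not_fg_finsupp : ¬ Group.FG (Multiplicative (ℕ →₀ ℤ)) := by
  intro h
  have h1 : AddGroup.FG (ℕ →₀ ℤ) := by
    rwa [AddGroup.fg_iff_mul_fg]
  have h2 : Module.Finite ℤ (ℕ →₀ ℤ) := Module.Finite.iff_addGroup_fg.2 h1
  have := Module.Finite.finite_basis (Finsupp.basisSingleOne (R := ℤ) (ι := ℕ))
  exact not_finite ℕ

theorem not_fg_commutator_three : ¬ Group.FG (commutator (SingularBraidGroup 3)) := by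
  intro h
  obtain ⟨e⟩ := nonempty_abelianization_mulEquiv
  exact not_fg_finsupp (Group.fg_of_surjective (f := e.toMonoidHom.comp Abelianization.of)
    (e.surjective.comp (QuotientGroup.mk'_surjective _)))

theorem not_isPerfect_commutator_three :
    ¬ Group.IsPerfect (commutator (SingularBraidGroup 3)) := by
  intro h
  obtain ⟨e⟩ := nonempty_abelianization_mulEquiv
  have : Group.IsPerfect (Multiplicative (ℕ →₀ ℤ)) :=
    Group.IsPerfect.ofSurjective (f := e.toMonoidHom.comp Abelianization.of)
      (e.surjective.comp (QuotientGroup.mk'_surjective _))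
  exact not_subsingleton (Multiplicative (ℕ →₀ ℤ))
    (Group.IsPerfect.subsingleton_of_isMulCommutative)

/-! ### Folding SG_4 onto SG_3 -/

/-- The index map `1, 2, 3 ↦ 1, 2, 1`. -/
def foldIndex (i : Fin (4 - 1)) : Fin (3 - 1) := ⟨i % 2, Nat.mod_lt _ two_pos⟩

theorem foldIndex_eq_of_far {i j : Fin (4 - 1)} (h : Far i j) : foldIndex i = foldIndex j := by
  simp only [Far] at h
  simp only [foldIndex, Fin.mk.injEq]
  omega

theorem foldIndex_succ {i j : Fin (4 - 1)} (h : (j : ℕ) = i + 1) :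
    (foldIndex j : ℕ) = foldIndex i + 1 ∨ (foldIndex i : ℕ) = foldIndex j + 1 := by
  simp only [foldIndex]
  omega

/-- The homomorphism `SG_4 → SG_3` sending `σ_1, σ_2, σ_3` to `σ_1, σ_2, σ_1`, and likewise for the
`ρ_i`. -/
def fold : SingularBraidGroup 4 →* SingularBraidGroup 3 :=
  lift (fun i => sigma (foldIndex i)) (fun i => rho (foldIndex i))
    (fun i j h => by rw [foldIndex_eq_of_far h])
    (fun i j h => by
      rcases foldIndex_succ h with h | h
      exacts [sigma_braid h, (sigma_braid h).symm])
    (fun i j h => by rw [foldIndex_eq_of_far h])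
    -- Where folding reverses the order of adjacent indices, the two mixed relations are
    -- interchanged.
    (fun i j h => by
      rcases foldIndex_succ h with h | h
      exacts [rho_mul_sigma_mul_sigma h, rho_succ_mul_sigma_mul_sigma h])
    (fun i j h => by
      rcases foldIndex_succ h with h | h
      exacts [rho_succ_mul_sigma_mul_sigma h, rho_mul_sigma_mul_sigma h])
    (fun i j h => (sigma_commute_rho (.inl (h.elim (congrArg _) foldIndex_eq_of_far))).eq)

theorem fold_surjective : Function.Surjective fold := by
  rw [← MonoidHom.range_eq_top]
  have h : ∀ i : Fin (3 - 1), ∃ j, foldIndex j = i := fun i =>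
    ⟨⟨i, by omega⟩, Fin.ext (Nat.mod_eq_of_lt i.2)⟩
  refine eq_top_of_mem (fun i => ?_) (fun i => ?_) <;> obtain ⟨j, rfl⟩ := h i
  exacts [⟨sigma j, by simp [fold]⟩, ⟨rho j, by simp [fold]⟩]

end SingularBraid

open SingularBraid in
theorem theorem1p1 :
    (∀ n : ℕ, 5 ≤ n →
      ∃ _ : Group.FG (commutator (SingularBraidGroup n)),
        Group.rank (commutator (SingularBraidGroup n)) ≤ 2 * n - 4) ∧
    ¬ Group.FG (commutator (SingularBraidGroup 3)) ∧
    ¬ Group.FG (commutator (SingularBraidGroup 4)) ∧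
    Nonempty (Abelianization (commutator (SingularBraidGroup 3)) ≃* Multiplicative (ℕ →₀ ℤ)) ∧
    (∀ n : ℕ, 3 ≤ n →
      (Group.IsPerfect (commutator (SingularBraidGroup n)) ↔ 5 ≤ n)) := by
  obtain ⟨g, hg⟩ := MonoidHom.exists_surjective_commutator fold_surjective
  refine ⟨fun n hn => exists_fg_commutator_and_rank_le hn, not_fg_commutator_three,
    fun h => not_fg_commutator_three (Group.fg_of_surjective hg),
    nonempty_abelianization_mulEquiv, fun n hn => ⟨fun h => ?_, isPerfect_commutator⟩⟩
  by_contra! h5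
  obtain rfl | rfl : n = 3 ∨ n = 4 := by omega
  · exact not_isPerfect_commutator_three h
  · exact not_isPerfect_commutator_three (Group.IsPerfect.ofSurjective hg)
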